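/- Let $b>0$ with $b\notin\mathbb Z$. A function $\pi\colon\mathbb R\to\mathbb R$ is a valid Gomory--Johnson function with right-hand side $b$ if it is nonnegative and $\sum_{r\in\mathbb R}\pi(r)\,y(r)\ge 1$ for all $x\in\mathbb Z$ and all finitely supported $y\colon\mathbb R\to\mathbb Z_{\ge 0}$ with $x+\sum_{r\in\mathbb R} r\,y(r)=b$; it is minimal if no other valid function is pointwise $\le\pi$. A function on an interval is piecewise linear (possibly discontinuous) if there is a locally finite set of breakpoints such that it is affine on each open interval of its domain containing no breakpoint; its slopes are the slopes it has on nondegenerate open intervals. A function $\phi\colon\mathbb R\to\mathbb R$ is a general dual-feasible function (gDFF) if $\sum_{i\in I}x_i\le 1$ implies $\sum_{i\in I}\phi(x_i)\le 1$ for every finite family of real numbers $(x_i)_{i\in I}$. A function $\phi\colon[0,1]\to[0,1]$ is a classical dual-feasible function (cDFF) if the same implication holds for every finite family in $[0,1]$. A gDFF (cDFF) is maximal if no other gDFF (cDFF) is pointwise $\ge\phi$, and a maximal one is extreme if it is not a convex combination of two other maximal gDFFs (cDFFs). Theorem. Let $\pi$ be a minimal piecewise linear Gomory--Johnson function with right-hand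 side $b$ that is continuous at $0$ from the right. For $\lambda\ne b$ put $\phi_\lambda(x)=\dfrac{bx-\lambda\pi(bx)}{b-\lambda}$, $x\in\mathbb R$. Then there is $\delta>0$ such that for all $0<\lambda<\delta$ the function $\phi_\lambda$ is a maximal gDFF, its restriction $\phi_\lambda|_{[0,1]}$ is a maximal cDFF, and (i) for every $k\in\mathbb N$, $\pi$ has exactly $k$ different slopes if and only if $\phi_\lambda$ has exactly $k$ different slopes; if $b>1$, then $\pi$ has exactly $k$ different slopes if and only if $\phi_\lambda|_{[0,1]}$ has exactly $k$ different slopes. Moreover: (ii) if $\pi$ is in addition continuous with exactly $2$ different slopes, its positive slope $s$ satisfies $sb>1$, and $\lambda=1/s$, then $\phi_\lambda$ is an extreme gDFF; if furthermore $b>3$, then $\phi_\lambda|_{[0,1]}$ is an extreme cDFF. -/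

import Mathlib

/-! Gomory-Johnson functions -/

/-- `π` is a valid Gomory-Johnson function for the row `x + ∑ r, r * y r = b`, where `x` is an
integer and `y : ℝ → ℤ₊` has finite support: `π` is nonnegative, and `∑ r, π r * y r ≥ 1` for
every feasible `(x, y)`. -/
def IsValidGJ (b : ℝ) (π : ℝ → ℝ) : Prop :=
  (∀ r, 0 ≤ π r) ∧
    ∀ (x : ℤ) (y : ℝ →₀ ℕ), (x : ℝ) + y.sum (fun r n => r * (n : ℝ)) = b →
      1 ≤ y.sum (fun r n => π r * (n : ℝ))

/-- A valid Gomory-Johnson function that is pointwise minimal among the valid ones. -/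
def IsMinimalGJ (b : ℝ) (π : ℝ → ℝ) : Prop :=
  IsValidGJ b π ∧ ∀ π' : ℝ → ℝ, IsValidGJ b π' → (∀ r, π' r ≤ π r) → π' = π

/-! Piecewise linear functions and their slopes -/

/-- The restriction of `f` to the set `D` is (possibly discontinuous) piecewise linear: there is a
locally finite set `B` of breakpoints such that `f` is affine on every open interval that lies in
`D` and contains no breakpoint. The values at the breakpoints are arbitrary. -/
def IsPiecewiseLinearOn (D : Set ℝ) (f : ℝ → ℝ) : Prop :=
  ∃ B : Set ℝ, (∀ u v : ℝ, (B ∩ Set.Icc u v).Finite) ∧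
    ∀ u v : ℝ, u < v → Set.Ioo u v ⊆ D → Disjoint B (Set.Ioo u v) →
      ∃ m k : ℝ, ∀ x ∈ Set.Ioo u v, f x = m * x + k

/-- The slopes of the restriction of `f` to `D`: the slopes that `f` has on nondegenerate open
intervals contained in `D`. -/
def slopeSet (D : Set ℝ) (f : ℝ → ℝ) : Set ℝ :=
  {m | ∃ u v k : ℝ, u < v ∧ Set.Ioo u v ⊆ D ∧ ∀ x ∈ Set.Ioo u v, f x = m * x + k}

/-- The restriction of `f` to `D` is piecewise linear with exactly `k` different slopes. -/
def HasSlopeCount (D : Set ℝ) (f : ℝ → ℝ) (k : ℕ) : Prop :=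
  IsPiecewiseLinearOn D f ∧ (slopeSet D f).encard = (k : ℕ∞)

/-! General dual-feasible functions -/

/-- Valid general dual-feasible functions. -/
def IsGeneralDFF (φ : ℝ → ℝ) : Prop :=
  ∀ (n : ℕ) (x : Fin n → ℝ), ∑ i, x i ≤ 1 → ∑ i, φ (x i) ≤ 1

/-- A general dual-feasible function that no other one dominates pointwise. -/
def IsMaximalGeneralDFF (φ : ℝ → ℝ) : Prop :=
  IsGeneralDFF φ ∧ ∀ ψ : ℝ → ℝ, IsGeneralDFF ψ → (∀ x, φ x ≤ ψ x) → ψ = φ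

/-- A maximal general dual-feasible function that is not a convex combination of two other
maximal general dual-feasible functions. -/
def IsExtremeGeneralDFF (φ : ℝ → ℝ) : Prop :=
  IsMaximalGeneralDFF φ ∧
    ¬ ∃ (φ₁ φ₂ : ℝ → ℝ) (t : ℝ), IsMaximalGeneralDFF φ₁ ∧ IsMaximalGeneralDFF φ₂ ∧
      φ₁ ≠ φ ∧ φ₂ ≠ φ ∧ 0 ≤ t ∧ t ≤ 1 ∧ ∀ x, φ x = t * φ₁ x + (1 - t) * φ₂ x

/-! Classical dual-feasible functions -/

/-- Valid classical dual-feasible functions `[0,1] → [0,1]`. -/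
def IsClassicalDFF (φ : Set.Icc (0 : ℝ) 1 → ℝ) : Prop :=
  (∀ x, φ x ∈ Set.Icc (0 : ℝ) 1) ∧
    ∀ (n : ℕ) (x : Fin n → Set.Icc (0 : ℝ) 1), ∑ i, (x i : ℝ) ≤ 1 → ∑ i, φ (x i) ≤ 1

/-- A classical dual-feasible function that no other one dominates pointwise. -/
def IsMaximalClassicalDFF (φ : Set.Icc (0 : ℝ) 1 → ℝ) : Prop :=
  IsClassicalDFF φ ∧
    ∀ ψ : Set.Icc (0 : ℝ) 1 → ℝ, IsClassicalDFF ψ → (∀ x, φ x ≤ ψ x) → ψ = φ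

/-- A maximal classical dual-feasible function that is not a convex combination of two other
maximal classical dual-feasible functions. -/
def IsExtremeClassicalDFF (φ : Set.Icc (0 : ℝ) 1 → ℝ) : Prop :=
  IsMaximalClassicalDFF φ ∧
    ¬ ∃ (φ₁ φ₂ : Set.Icc (0 : ℝ) 1 → ℝ) (t : ℝ),
      IsMaximalClassicalDFF φ₁ ∧ IsMaximalClassicalDFF φ₂ ∧
      φ₁ ≠ φ ∧ φ₂ ≠ φ ∧ 0 ≤ t ∧ t ≤ 1 ∧ ∀ x, φ x = t * φ₁ x + (1 - t) * φ₂ x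

/-! The conversion -/

/-- The function `x ↦ (b x - lam π(b x)) / (b - lam)`. -/
noncomputable def gjToDFF (b : ℝ) (π : ℝ → ℝ) (lam : ℝ) (x : ℝ) : ℝ :=
  (b * x - lam * π (b * x)) / (b - lam)

/-! Minimal Gomory-Johnson functions -/

/-! Minimality forces `π 0 = 0`, `π ≤ 1`, period 1, subadditivity and `π r + π (b - r) = 1`. Each
follows because a value violating the property could be lowered at one point. Subtracting `lam * π`
from the identity and rescaling by `b` turns these into `φ 0 = 0`, superadditivity and `φ x + φ (1 -
x) = 1`. Nonnegativity for `x ≥ 0` amounts to `lam * π r ≤ r`: near `0` this holds for small `lam`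
because `π` is linear there from the right, and away from `0` because `π ≤ 1`. These properties give
maximality. Slopes change by an injective affine map, and `[0, 1]` rescales to `[0, b]`, which
contains a full period when `b > 1`.

For extremality let `π` have slopes `s > 0 > q` and `lam = 1 / s`; then `φ` is constant where `π`
has slope `s`. A summand `f` of `φ` is monotone, symmetric, superadditive, and additive wherever `φ`
is. Its increments are at most those of `φ / t`, so `f` is continuous and constant where `φ` is.
Since `π` has slope `q` just left of each integer, `π` is additive at pairs of a point of slope `q`
and a point there; additivity carries a derivative of `f` from the second to the first
(`exists_hasDerivAt_transfer`). A monotone function is differentiable almost everywhere, so `f` has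
one common derivative on all pieces of slope `q`. Hence `f` is a multiple of `φ`, and `f 1 = 1`
fixes the factor. -/

theorem isValidGJ_iff_multiset {b : ℝ} {π : ℝ → ℝ} :
    IsValidGJ b π ↔ (∀ r, 0 ≤ π r) ∧
      ∀ (x : ℤ) (s : Multiset ℝ), (x : ℝ) + s.sum = b → 1 ≤ (s.map π).sum := by
  have key : ∀ (s : Multiset ℝ) (f : ℝ → ℝ),
      (Multiset.toFinsupp s).sum (fun r n => f r * (n : ℝ)) = (s.map f).sum := by
    intro s f
    rw [Finset.sum_multiset_map_count, Finsupp.sum]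
    simp [mul_comm]
  unfold IsValidGJ
  refine and_congr_right fun _ => forall_congr' fun x => ⟨fun h s hs => ?_, fun h y hy => ?_⟩
  · rw [← key]
    apply h
    rw [key s (fun r => r)]
    simpa using hs
  · have hy' : y = Multiset.toFinsupp (Finsupp.toMultiset y) := by simp
    rw [hy'] at hy ⊢
    rw [key _ (fun r => r)] at hy
    rw [key]
    apply h
    simpa using hy

theorem Multiset.eq_replicate_count_add_filter {α : Type*} [DecidableEq α] (s : Multiset α)
    (r : α) : s = Multiset.replicate (s.count r) r + s.filter (fun a => a ≠ r) := by
  conv_lhs => rw [← Multiset.filter_add_not (fun a => a = r) s]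
  rw [Multiset.filter_eq']

namespace IsMinimalGJ

variable {b : ℝ} {π : ℝ → ℝ}

theorem nonneg (h : IsMinimalGJ b π) (r : ℝ) : 0 ≤ π r := h.1.1 r

theorem one_le_sum (h : IsMinimalGJ b π) (x : ℤ) (s : Multiset ℝ) (hs : (x : ℝ) + s.sum = b) :
    1 ≤ (s.map π).sum := (isValidGJ_iff_multiset.1 h.1).2 x s hs

/-- The value of a minimal function at a single point cannot be lowered. -/
theorem eq_of_update (h : IsMinimalGJ b π) {r v : ℝ} (hv : 0 ≤ v) (hvr : v ≤ π r)
    (H : ∀ (n : ℕ) (x : ℤ) (s : Multiset ℝ), 1 ≤ n → (x : ℝ) + (n * r + s.sum) = b →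
      1 ≤ n * v + (s.map π).sum) : v = π r := by
  have hval : IsValidGJ b (Function.update π r v) := by
    rw [isValidGJ_iff_multiset]
    refine ⟨fun q => ?_, fun x s hs => ?_⟩
    · rcases eq_or_ne q r with rfl | hq
      · simpa using hv
      · simpa [hq] using h.nonneg q
    · have hsplit := Multiset.eq_replicate_count_add_filter s r
      set t := s.filter (fun a => a ≠ r) with ht
      have hmap : t.map (Function.update π r v) = t.map π := by
        refine Multiset.map_congr rfl fun q hq => ?_
        have : q ≠ r := (Multiset.mem_filter.1 hq).2
        simp [this]
      rw [hsplit] at hs ⊢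
      generalize s.count r = n at hs ⊢
      simp only [Multiset.sum_add, Multiset.sum_replicate, nsmul_eq_mul, Multiset.map_add,
        Multiset.map_replicate, Function.update_self, hmap] at hs ⊢
      rcases Nat.eq_zero_or_pos n with rfl | hn
      · have := h.one_le_sum x t (by simpa using hs)
        simpa using this
      · exact H n x t hn hs
  have := h.2 _ hval (fun q => by
    rcases eq_or_ne q r with rfl | hq
    · simpa using hvr
    · simp [hq])
  simpa using congrFun this r

theorem map_sum_nonneg (h : IsMinimalGJ b π) (s : Multiset ℝ) : 0 ≤ (s.map π).sum := by
  refine Multiset.sum_nonneg fun q hq => ?_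
  obtain ⟨r, _, rfl⟩ := Multiset.mem_map.1 hq
  exact h.nonneg r

theorem map_zero (h : IsMinimalGJ b π) : π 0 = 0 := by
  refine (h.eq_of_update (r := 0) le_rfl (h.nonneg 0) fun n x s _ hs => ?_).symm
  simpa using h.one_le_sum x s (by simpa using hs)

theorem le_one (h : IsMinimalGJ b π) (r : ℝ) : π r ≤ 1 := by
  by_contra! hr
  refine hr.ne (h.eq_of_update zero_le_one hr.le fun n x s hn _ => ?_)
  have : (1 : ℝ) ≤ n := by exact_mod_cast hn
  linarith [h.map_sum_nonneg s]

/-- The integer variable absorbs the shift of each copy of `r`, so the smaller of the two values is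
valid at both points. -/
theorem map_add_int (h : IsMinimalGJ b π) (r : ℝ) (k : ℤ) : π (r + k) = π r := by
  have key : ∀ (r : ℝ) (k : ℤ), π r ≤ π (r + k) := by
    intro r k
    by_contra! hlt
    refine hlt.ne (h.eq_of_update (h.nonneg _) hlt.le fun n x s _ hs => ?_)
    have := h.one_le_sum (x - n * k) (Multiset.replicate n (r + k) + s) (by
      simp only [Multiset.sum_add, Multiset.sum_replicate, nsmul_eq_mul]
      push_cast
      linarith)
    simpa using this
  refine le_antisymm ?_ (key r k)
  simpa using key (r + k) (-k)

theorem add_le (h : IsMinimalGJ b π) (p q : ℝ) : π (p + q) ≤ π p + π q := by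
  by_contra! hlt
  refine hlt.ne (h.eq_of_update (add_nonneg (h.nonneg _) (h.nonneg _)) hlt.le
    fun n x s _ hs => ?_)
  have := h.one_le_sum x (Multiset.replicate n p + Multiset.replicate n q + s) (by
    simp only [Multiset.sum_add, Multiset.sum_replicate, nsmul_eq_mul]
    linarith)
  simp only [Multiset.map_add, Multiset.sum_add, Multiset.map_replicate, Multiset.sum_replicate,
    nsmul_eq_mul] at this
  linarith

theorem map_sum_le (h : IsMinimalGJ b π) (s : Multiset ℝ) : π s.sum ≤ (s.map π).sum := by
  induction s using Multiset.induction with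
  | empty => simp [h.map_zero]
  | cons a s ih =>
    simp only [Multiset.sum_cons, Multiset.map_cons]
    linarith [h.add_le a s.sum]

/-- If the sum `T` exceeded 1, the value at `r` could be lowered to `π r / T`. In a solution
containing `r`, all terms but one copy of `r` add up to `b - r` modulo 1, so by subadditivity their
total is at least `π (b - r)`. The full total is thus at least `T`, and dividing by `T` leaves at
least 1. -/
theorem add_sub_eq_one (h : IsMinimalGJ b π) (r : ℝ) : π r + π (b - r) = 1 := by
  have hge : 1 ≤ π r + π (b - r) := by
    simpa using h.one_le_sum 0 {r, b - r} (by simp)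
  refine le_antisymm ?_ hge
  by_contra! hlt
  have hpos : 0 < π r := by linarith [h.le_one (b - r)]
  set T := π r + π (b - r) with hT
  have hT0 : 0 < T := by linarith
  have hlt' : π r / T < π r := div_lt_self hpos hlt
  refine hlt'.ne (h.eq_of_update (by positivity) hlt'.le fun n x s hn hs => ?_)
  obtain ⟨m, rfl⟩ := Nat.exists_eq_add_of_le' hn
  have h1 := h.map_sum_le (Multiset.replicate m r + s)
  have h2 : π ((Multiset.replicate m r + s).sum) = π (b - r) := by
    have : (Multiset.replicate m r + s).sum = b - r + ((-x : ℤ) : ℝ) := by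
      simp only [Multiset.sum_add, Multiset.sum_replicate, nsmul_eq_mul]
      push_cast at hs ⊢
      linarith
    rw [this, h.map_add_int]
  rw [h2] at h1
  simp only [Multiset.map_add, Multiset.sum_add, Multiset.map_replicate, Multiset.sum_replicate,
    nsmul_eq_mul] at h1
  have hS := h.map_sum_nonneg s
  have h3 : (s.map π).sum / T ≤ (s.map π).sum := div_le_self hS hge
  have h4 : 1 ≤ ((m + 1) * π r + (s.map π).sum) / T := by
    rw [le_div_iff₀ hT0]
    linarith
  calc (1 : ℝ) ≤ ((m + 1) * π r + (s.map π).sum) / T := h4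
    _ = (m + 1) * (π r / T) + (s.map π).sum / T := by ring
    _ ≤ _ := by push_cast; linarith

theorem map_rhs (h : IsMinimalGJ b π) : π b = 1 := by
  have := h.add_sub_eq_one b
  rwa [sub_self, h.map_zero, add_zero] at this

end IsMinimalGJ

/-! Dual-feasible functions -/

theorem sum_map_le_of_superadditive {φ : ℝ → ℝ} (h0 : φ 0 = 0)
    (hsup : ∀ x y, φ x + φ y ≤ φ (x + y)) {ι : Type*} (s : Finset ι) (x : ι → ℝ) :
    ∑ i ∈ s, φ (x i) ≤ φ (∑ i ∈ s, x i) := by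
  classical
  induction s using Finset.induction_on with
  | empty => simp [h0]
  | insert a s ha ih =>
    rw [Finset.sum_insert ha, Finset.sum_insert ha]
    linarith [hsup (x a) (∑ i ∈ s, x i)]

theorem monotone_of_superadditive {φ : ℝ → ℝ} (hsup : ∀ x y, φ x + φ y ≤ φ (x + y))
    (hnn : ∀ x, 0 ≤ x → 0 ≤ φ x) : Monotone φ := by
  intro x y hxy
  have := hsup x (y - x)
  rw [add_sub_cancel] at this
  linarith [hnn (y - x) (by linarith)]

theorem sum_map_le_one_of_superadditive {φ : ℝ → ℝ} (h0 : φ 0 = 0)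
    (hsup : ∀ x y, φ x + φ y ≤ φ (x + y)) (hnn : ∀ x, 0 ≤ x → 0 ≤ φ x)
    (hsym : ∀ x, φ x + φ (1 - x) = 1) : IsGeneralDFF φ := by
  intro n x hx
  have h1 : φ 1 = 1 := by
    have := hsym 1
    rwa [sub_self, h0, add_zero] at this
  calc ∑ i, φ (x i) ≤ φ (∑ i, x i) := sum_map_le_of_superadditive h0 hsup _ _
    _ ≤ φ 1 := monotone_of_superadditive hsup hnn hx
    _ = 1 := h1

/-- Symmetry leaves no room to grow: a dominating `ψ` has `ψ x + ψ (1 - x) ≤ 1`, a bound that `φ`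
already attains. -/
theorem isMaximalGeneralDFF_of_superadditive {φ : ℝ → ℝ} (h0 : φ 0 = 0)
    (hsup : ∀ x y, φ x + φ y ≤ φ (x + y)) (hnn : ∀ x, 0 ≤ x → 0 ≤ φ x)
    (hsym : ∀ x, φ x + φ (1 - x) = 1) : IsMaximalGeneralDFF φ := by
  refine ⟨sum_map_le_one_of_superadditive h0 hsup hnn hsym, fun ψ hψ hle => funext fun x => ?_⟩
  have := hψ 2 ![x, 1 - x] (by simp)
  simp only [Fin.sum_univ_two, Matrix.cons_val_zero, Matrix.cons_val_one] at this
  linarith [hle x, hle (1 - x), hsym x]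

theorem isMaximalClassicalDFF_of_superadditive {φ : ℝ → ℝ} (h0 : φ 0 = 0)
    (hsup : ∀ x y, φ x + φ y ≤ φ (x + y)) (hnn : ∀ x, 0 ≤ x → 0 ≤ φ x)
    (hsym : ∀ x, φ x + φ (1 - x) = 1) :
    IsMaximalClassicalDFF ((Set.Icc (0 : ℝ) 1).domRestrict φ) := by
  refine ⟨⟨fun x => ⟨hnn _ x.2.1, ?_⟩, fun n x hx => ?_⟩, fun ψ hψ hle => funext fun x => ?_⟩
  · have := hnn (1 - x) (by linarith [x.2.2])
    have := hsym x
    simp only [Set.domRestrict_apply]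
    linarith
  · exact sum_map_le_one_of_superadditive h0 hsup hnn hsym n (fun i => (x i : ℝ)) hx
  · have := hψ.2 2 ![x, unitInterval.symm x] (by simp)
    simp only [Fin.sum_univ_two, Matrix.cons_val_zero, Matrix.cons_val_one] at this
    have h1 := hle x
    have h2 := hle (unitInterval.symm x)
    simp only [Set.domRestrict_apply, unitInterval.coe_symm_eq] at h1 h2 ⊢
    linarith [hsym x]

/-! ### Maximality of the converted function -/

section Conversion

variable {b lam : ℝ} {π : ℝ → ℝ}

theorem gjToDFF_zero (h : IsMinimalGJ b π) : gjToDFF b π lam 0 = 0 := by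
  simp [gjToDFF, h.map_zero]

theorem gjToDFF_add_one_sub (h : IsMinimalGJ b π) (hlb : lam < b) (x : ℝ) :
    gjToDFF b π lam x + gjToDFF b π lam (1 - x) = 1 := by
  have := h.add_sub_eq_one (b * x)
  have e : b * (1 - x) = b - b * x := by ring
  unfold gjToDFF
  rw [e, ← add_div, div_eq_one_iff_eq (by linarith)]
  linear_combination (-lam) * this

theorem gjToDFF_superadditive (h : IsMinimalGJ b π) (hl : 0 ≤ lam) (hlb : lam < b) (x y : ℝ) :
    gjToDFF b π lam x + gjToDFF b π lam y ≤ gjToDFF b π lam (x + y) := by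
  have := mul_le_mul_of_nonneg_left (h.add_le (b * x) (b * y)) hl
  have e : b * (x + y) = b * x + b * y := by ring
  unfold gjToDFF
  rw [e, ← add_div]
  refine div_le_div_of_nonneg_right ?_ (by linarith)
  linarith

theorem gjToDFF_nonneg (hb : 0 < b) (hlb : lam < b) (hle : ∀ r, 0 ≤ r → lam * π r ≤ r)
    (x : ℝ) (hx : 0 ≤ x) : 0 ≤ gjToDFF b π lam x :=
  div_nonneg (by linarith [hle (b * x) (by positivity)]) (by linarith)

theorem gjToDFF_maximal (hb : 0 < b) (h : IsMinimalGJ b π) (hl : 0 ≤ lam) (hlb : lam < b)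
    (hle : ∀ r, 0 ≤ r → lam * π r ≤ r) :
    IsMaximalGeneralDFF (gjToDFF b π lam) ∧
      IsMaximalClassicalDFF ((Set.Icc (0 : ℝ) 1).domRestrict (gjToDFF b π lam)) :=
  ⟨isMaximalGeneralDFF_of_superadditive (gjToDFF_zero h) (gjToDFF_superadditive h hl hlb)
    (gjToDFF_nonneg hb hlb hle) (gjToDFF_add_one_sub h hlb),
  isMaximalClassicalDFF_of_superadditive (gjToDFF_zero h) (gjToDFF_superadditive h hl hlb)
    (gjToDFF_nonneg hb hlb hle) (gjToDFF_add_one_sub h hlb)⟩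

end Conversion

/-! Piecewise linear functions -/

theorem exists_forall_mem_eq_of_finite_inter_Icc {B : Set ℝ}
    (hB : ∀ u v : ℝ, (B ∩ Set.Icc u v).Finite) (x : ℝ) :
    ∃ ε > 0, ∀ y ∈ B, |y - x| < ε → y = x := by
  have hfin : ((B ∩ Set.Icc (x - 1) (x + 1)) \ {x}).Finite := (hB _ _).sdiff
  have hnhds : ((B ∩ Set.Icc (x - 1) (x + 1)) \ {x})ᶜ ∈ nhds x :=
    hfin.isClosed.isOpen_compl.mem_nhds (by simp)
  obtain ⟨ε, hε, hball⟩ := Metric.mem_nhds_iff.1 hnhds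
  refine ⟨min ε 1, lt_min hε one_pos, fun y hy hyx => ?_⟩
  have h1 := lt_of_lt_of_le hyx (min_le_left _ _)
  have h2 := abs_lt.1 (lt_of_lt_of_le hyx (min_le_right _ _))
  by_contra hne
  exact hball (by simpa [Real.dist_eq] using h1)
    ⟨⟨hy, by linarith, by linarith⟩, by simpa using hne⟩

theorem countable_of_finite_inter_Icc {B : Set ℝ} (hB : ∀ u v : ℝ, (B ∩ Set.Icc u v).Finite) :
    B.Countable := by
  have : B ⊆ ⋃ n : ℕ, B ∩ Set.Icc (-(n : ℝ)) n := by
    intro x hx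
    obtain ⟨n, hn⟩ := exists_nat_ge |x|
    exact Set.mem_iUnion.2 ⟨n, hx, abs_le.1 hn⟩
  exact (Set.countable_iUnion fun n => (hB _ _).countable).mono this

theorem IsPiecewiseLinearOn.mono {D E : Set ℝ} {f : ℝ → ℝ} (hf : IsPiecewiseLinearOn E f)
    (hDE : D ⊆ E) : IsPiecewiseLinearOn D f := by
  obtain ⟨B, hB, h⟩ := hf
  exact ⟨B, hB, fun u v huv hsub => h u v huv (hsub.trans hDE)⟩

namespace IsPiecewiseLinearOn

variable {f : ℝ → ℝ}

theorem exists_affine_right (hf : IsPiecewiseLinearOn Set.univ f) (x : ℝ) :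
    ∃ m ∈ slopeSet Set.univ f, ∃ k : ℝ, ∃ ε > 0, ∀ y ∈ Set.Ioo x (x + ε), f y = m * y + k := by
  obtain ⟨B, hB, h⟩ := hf
  obtain ⟨ε, hε, hx⟩ := exists_forall_mem_eq_of_finite_inter_Icc hB x
  obtain ⟨m, k, hmk⟩ := h x (x + ε) (by linarith) (Set.subset_univ _) (by
    rw [Set.disjoint_left]
    intro y hy hy'
    exact hy'.1.ne' (hx y hy (abs_lt.2 ⟨by linarith [hy'.1], by linarith [hy'.2]⟩)))
  exact ⟨m, ⟨x, x + ε, k, by linarith, Set.subset_univ _, hmk⟩, k, ε, hε, hmk⟩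

theorem exists_affine_left (hf : IsPiecewiseLinearOn Set.univ f) (x : ℝ) :
    ∃ m ∈ slopeSet Set.univ f, ∃ k : ℝ, ∃ ε > 0, ∀ y ∈ Set.Ioo (x - ε) x, f y = m * y + k := by
  obtain ⟨B, hB, h⟩ := hf
  obtain ⟨ε, hε, hx⟩ := exists_forall_mem_eq_of_finite_inter_Icc hB x
  obtain ⟨m, k, hmk⟩ := h (x - ε) x (by linarith) (Set.subset_univ _) (by
    rw [Set.disjoint_left]
    intro y hy hy'
    exact hy'.2.ne (hx y hy (abs_lt.2 ⟨by linarith [hy'.1], by linarith [hy'.2]⟩)))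
  exact ⟨m, ⟨x - ε, x, k, by linarith, Set.subset_univ _, hmk⟩, k, ε, hε, hmk⟩

/-- Off a countable set, a piecewise linear function is affine near each point. -/
theorem exists_countable_affine (hf : IsPiecewiseLinearOn Set.univ f) :
    ∃ B : Set ℝ, B.Countable ∧ ∀ x ∉ B, ∃ m ∈ slopeSet Set.univ f, ∃ ε > 0,
      ∀ h, |h| < ε → f (x + h) = f x + m * h := by
  obtain ⟨B, hB, h⟩ := hf
  refine ⟨B, countable_of_finite_inter_Icc hB, fun x hxB => ?_⟩
  obtain ⟨ε, hε, hx⟩ := exists_forall_mem_eq_of_finite_inter_Icc hB x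
  obtain ⟨m, k, hmk⟩ := h (x - ε) (x + ε) (by linarith) (Set.subset_univ _) (by
    rw [Set.disjoint_left]
    intro y hy hy'
    exact hxB (hx y hy (abs_lt.2 ⟨by linarith [hy'.1], by linarith [hy'.2]⟩) ▸ hy))
  refine ⟨m, ⟨x - ε, x + ε, k, by linarith, Set.subset_univ _, hmk⟩, ε, hε, fun t ht => ?_⟩
  rw [abs_lt] at ht
  rw [hmk x ⟨by linarith, by linarith⟩, hmk (x + t) ⟨by linarith, by linarith⟩]
  ring

theorem exists_slope_right (hf : IsPiecewiseLinearOn Set.univ f) {x : ℝ}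
    (hc : ContinuousWithinAt f (Set.Ici x) x) :
    ∃ m ∈ slopeSet Set.univ f, ∃ ε > 0, ∀ h, 0 ≤ h → h < ε → f (x + h) = f x + m * h := by
  obtain ⟨m, hm, k, ε, hε, hmk⟩ := hf.exists_affine_right x
  have hx : f x = m * x + k := by
    have h1 : Filter.Tendsto f (nhdsWithin x (Set.Ioi x)) (nhds (f x)) :=
      hc.mono Set.Ioi_subset_Ici_self
    have h2 : Filter.Tendsto (fun y => m * y + k) (nhdsWithin x (Set.Ioi x))
        (nhds (m * x + k)) := by
      have : Continuous fun y : ℝ => m * y + k := by fun_prop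
      exact this.continuousAt.tendsto.mono_left nhdsWithin_le_nhds
    refine tendsto_nhds_unique h1 (h2.congr' ?_)
    filter_upwards [Ioo_mem_nhdsGT (show x < x + ε by linarith)] with y hy
    exact (hmk y hy).symm
  refine ⟨m, hm, ε, hε, fun h h0 hh => ?_⟩
  rcases h0.eq_or_lt with rfl | h0
  · simp
  · rw [hmk (x + h) ⟨by linarith, by linarith⟩, hx]
    ring

theorem exists_slope_left (hf : IsPiecewiseLinearOn Set.univ f) {x : ℝ}
    (hc : ContinuousWithinAt f (Set.Iic x) x) :
    ∃ m ∈ slopeSet Set.univ f, ∃ ε > 0, ∀ h, 0 ≤ h → h < ε → f (x - h) = f x - m * h := by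
  obtain ⟨m, hm, k, ε, hε, hmk⟩ := hf.exists_affine_left x
  have hx : f x = m * x + k := by
    have h1 : Filter.Tendsto f (nhdsWithin x (Set.Iio x)) (nhds (f x)) :=
      hc.mono Set.Iio_subset_Iic_self
    have h2 : Filter.Tendsto (fun y => m * y + k) (nhdsWithin x (Set.Iio x))
        (nhds (m * x + k)) := by
      have : Continuous fun y : ℝ => m * y + k := by fun_prop
      exact this.continuousAt.tendsto.mono_left nhdsWithin_le_nhds
    refine tendsto_nhds_unique h1 (h2.congr' ?_)
    filter_upwards [Ioo_mem_nhdsLT (show x - ε < x by linarith)] with y hy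
    exact (hmk y hy).symm
  refine ⟨m, hm, ε, hε, fun h h0 hh => ?_⟩
  rcases h0.eq_or_lt with rfl | h0
  · simp
  · rw [hmk (x - h) ⟨by linarith, by linarith⟩, hx]
    ring

theorem exists_rightDeriv (hf : IsPiecewiseLinearOn Set.univ f) (hc : Continuous f) (x : ℝ) :
    ∃ m ∈ slopeSet Set.univ f, HasDerivWithinAt f m (Set.Ici x) x := by
  obtain ⟨m, hm, ε, hε, h⟩ := hf.exists_slope_right (hc.continuousWithinAt (s := Set.Ici x))
  refine ⟨m, hm, ?_⟩
  have hlin : HasDerivWithinAt (fun y => f x + m * (y - x)) m (Set.Ici x) x := by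
    simpa using ((((hasDerivAt_id x).sub_const x).const_mul m).const_add (f x)).hasDerivWithinAt
  refine hlin.congr_of_eventuallyEq ?_ (by simp)
  filter_upwards [Ico_mem_nhdsGE (show x < x + ε by linarith)] with y hy
  have := h (y - x) (by linarith [hy.1]) (by linarith [hy.2])
  rwa [add_sub_cancel] at this

/-- Continuity makes each point have a right derivative among the slopes, so a one-sided derivative
comparison applies. -/
theorem sub_le_of_slope_le (hf : IsPiecewiseLinearOn Set.univ f) (hc : Continuous f) {M : ℝ}
    (hM : ∀ m ∈ slopeSet Set.univ f, m ≤ M) {x y : ℝ} (hxy : x ≤ y) :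
    f y - f x ≤ M * (y - x) := by
  choose f' hmem hf' using hf.exists_rightDeriv hc
  have := image_le_of_deriv_right_le_deriv_boundary (f := f) (f' := f') (a := x) (b := y)
    (B := fun z => f x + M * (z - x)) (B' := fun _ => M) hc.continuousOn (fun z _ => hf' z)
    (by simp) (by fun_prop) (fun z _ => by
      simpa using
        ((((hasDerivAt_id z).sub_const x).const_mul M).const_add (f x)).hasDerivWithinAt)
    (fun z _ => hM _ (hmem z)) (Set.right_mem_Icc.2 hxy)
  linarith

theorem le_sub_of_le_slope (hf : IsPiecewiseLinearOn Set.univ f) (hc : Continuous f) {M : ℝ}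
    (hM : ∀ m ∈ slopeSet Set.univ f, M ≤ m) {x y : ℝ} (hxy : x ≤ y) :
    M * (y - x) ≤ f y - f x := by
  choose f' hmem hf' using hf.exists_rightDeriv hc
  have := image_le_of_deriv_right_le_deriv_boundary (f := fun z => f x + M * (z - x))
    (f' := fun _ => M) (a := x) (b := y) (B := f) (B' := f') (by fun_prop) (fun z _ => by
      simpa using
        ((((hasDerivAt_id z).sub_const x).const_mul M).const_add (f x)).hasDerivWithinAt)
    (by simp) hc.continuousOn (fun z _ => hf' z)
    (fun z _ => hM _ (hmem z)) (Set.right_mem_Icc.2 hxy)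
  linarith

end IsPiecewiseLinearOn

/-! Slopes of the converted function -/

theorem gjToDFF_isPiecewiseLinearOn {b lam : ℝ} {π : ℝ → ℝ} (hb : 0 < b)
    (hπ : IsPiecewiseLinearOn Set.univ π) :
    IsPiecewiseLinearOn Set.univ (gjToDFF b π lam) := by
  obtain ⟨B, hB, h⟩ := hπ
  refine ⟨(fun x => b * x) ⁻¹' B, fun u v => ?_, fun u v huv _ hdisj => ?_⟩
  · refine ((hB (b * u) (b * v)).preimage
      ((mul_right_injective₀ hb.ne').injOn (s := Set.univ) |>.mono (Set.subset_univ _))).subset ?_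
    rintro x ⟨hx, h1, h2⟩
    exact ⟨hx, mul_le_mul_of_nonneg_left h1 hb.le, mul_le_mul_of_nonneg_left h2 hb.le⟩
  · obtain ⟨m, k, hmk⟩ := h (b * u) (b * v) (mul_lt_mul_of_pos_left huv hb)
      (Set.subset_univ _) (by
        rw [Set.disjoint_left] at hdisj ⊢
        rintro y hy ⟨h1, h2⟩
        refine hdisj (a := y / b) ?_ ⟨?_, ?_⟩
        · rw [Set.mem_preimage]
          rwa [mul_div_cancel₀ _ hb.ne']
        · rw [lt_div_iff₀ hb]; linarith
        · rw [div_lt_iff₀ hb]; linarith)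
    refine ⟨(b - lam * (m * b)) / (b - lam), -(lam * k) / (b - lam), fun x hx => ?_⟩
    rw [gjToDFF, hmk (b * x)
      ⟨mul_lt_mul_of_pos_left hx.1 hb, mul_lt_mul_of_pos_left hx.2 hb⟩]
    ring

theorem slopeSet_gjToDFF {b lam : ℝ} {π : ℝ → ℝ} (hb : 0 < b) (hl : 0 < lam) (hlb : lam < b)
    (D : Set ℝ) : slopeSet D (gjToDFF b π lam) =
      (fun m => (b - lam * (m * b)) / (b - lam)) '' slopeSet ((fun x => x / b) ⁻¹' D) π := by
  have hbl : b - lam ≠ 0 := by linarith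
  ext m
  constructor
  · rintro ⟨u, v, k, huv, hsub, h⟩
    have hmem : ∀ y ∈ Set.Ioo (b * u) (b * v), y / b ∈ Set.Ioo u v := fun y hy =>
      ⟨by rw [lt_div_iff₀ hb]; linarith [hy.1], by rw [div_lt_iff₀ hb]; linarith [hy.2]⟩
    -- The witness inverts the affine map of slopes, as obtained by solving the definition of
    -- `gjToDFF` for `π`.
    refine ⟨(1 - (b - lam) * m / b) / lam, ⟨b * u, b * v, -((b - lam) * k) / lam,
      mul_lt_mul_of_pos_left huv hb, fun y hy => hsub (hmem y hy), fun y hy => ?_⟩, ?_⟩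
    · have := h _ (hmem y hy)
      rw [gjToDFF, mul_div_cancel₀ _ hb.ne', div_eq_iff hbl] at this
      field_simp
      field_simp at this
      linarith
    · field_simp
      ring
  · rintro ⟨m, ⟨u, v, k, huv, hsub, h⟩, rfl⟩
    have hmem : ∀ y ∈ Set.Ioo (u / b) (v / b), b * y ∈ Set.Ioo u v := fun y hy =>
      ⟨by linarith [(div_lt_iff₀ hb).1 hy.1], by linarith [(lt_div_iff₀ hb).1 hy.2]⟩
    refine ⟨u / b, v / b, -(lam * k) / (b - lam), div_lt_div_of_pos_right huv hb,
      fun y hy => ?_, fun y hy => ?_⟩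
    · have := hsub (hmem y hy)
      rwa [Set.mem_preimage, mul_div_cancel_left₀ _ hb.ne'] at this
    · rw [gjToDFF, h _ (hmem y hy)]
      ring

theorem slopeSet_mono {D E : Set ℝ} (hDE : D ⊆ E) (f : ℝ → ℝ) : slopeSet D f ⊆ slopeSet E f := by
  rintro m ⟨u, v, k, huv, hsub, h⟩
  exact ⟨u, v, k, huv, hsub.trans hDE, h⟩

/-- All slopes of a function with period `1` occur on the interval `[0, b]` when `1 ≤ b`. -/
theorem slopeSet_Icc_of_periodic {f : ℝ → ℝ} (hf : ∀ (r : ℝ) (k : ℤ), f (r + k) = f r) {b : ℝ}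
    (hb : 1 ≤ b) : slopeSet (Set.Icc 0 b) f = slopeSet Set.univ f := by
  refine (slopeSet_mono (Set.subset_univ _) f).antisymm ?_
  rintro m ⟨u, v, k, huv, -, h⟩
  have h1 := Int.floor_le u
  have h2 := Int.lt_floor_add_one u
  -- Translation by `⌊u⌋` puts the left end in `[0, 1)`; cutting at 1 keeps the interval inside `[0,
  -- b]`.
  refine ⟨u - ⌊u⌋, min (v - ⌊u⌋) 1, m * ⌊u⌋ + k, lt_min (by linarith) (by linarith), ?_, ?_⟩
  · rintro x ⟨hx1, hx2⟩
    exact ⟨by linarith, (hx2.le.trans (min_le_right _ _)).trans hb⟩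
  · rintro x ⟨hx1, hx2⟩
    have hx3 := lt_of_lt_of_le hx2 (min_le_left _ _)
    rw [← hf x ⌊u⌋, h _ ⟨by linarith, by linarith⟩]
    ring

theorem hasSlopeCount_gjToDFF_iff {b lam : ℝ} {π : ℝ → ℝ} (hb : 0 < b) (hl : 0 < lam)
    (hlb : lam < b) (hπ : IsPiecewiseLinearOn Set.univ π) {D : Set ℝ}
    (hD : slopeSet ((fun x => x / b) ⁻¹' D) π = slopeSet Set.univ π) (k : ℕ) :
    HasSlopeCount Set.univ π k ↔ HasSlopeCount D (gjToDFF b π lam) k := by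
  have hinj : Function.Injective fun m : ℝ => (b - lam * (m * b)) / (b - lam) := by
    intro m n hmn
    have hbl : b - lam ≠ 0 := by linarith
    simp only [div_left_inj' hbl, sub_right_inj] at hmn
    exact mul_right_cancel₀ hb.ne' (mul_left_cancel₀ hl.ne' hmn)
  unfold HasSlopeCount
  rw [slopeSet_gjToDFF hb hl hlb, hD, hinj.encard_image]
  exact and_congr_left fun _ =>
    ⟨fun _ => (gjToDFF_isPiecewiseLinearOn hb hπ).mono (Set.subset_univ _), fun _ => hπ⟩

theorem exists_forall_mul_le_self {b : ℝ} {π : ℝ → ℝ} (h : IsMinimalGJ b π)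
    (hπ : IsPiecewiseLinearOn Set.univ π) (hc : ContinuousWithinAt π (Set.Ici 0) 0) :
    ∃ δ > 0, ∀ lam, 0 < lam → lam < δ → ∀ r, 0 ≤ r → lam * π r ≤ r := by
  obtain ⟨m, -, ε, hε, hm⟩ := hπ.exists_slope_right hc
  -- The second bound gives `lam * m ≤ 1` on `[0, ε)`; the first gives `lam * π r ≤ lam ≤ r` beyond.
  refine ⟨min ε (1 / (|m| + 1)), lt_min hε (by positivity), fun lam hl hlt r hr => ?_⟩
  have h1 := lt_of_lt_of_le hlt (min_le_left _ _)
  have h2 := lt_of_lt_of_le hlt (min_le_right _ _)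
  rw [lt_div_iff₀ (by positivity)] at h2
  rcases lt_or_ge r ε with hrε | hrε
  · have h3 := hm r hr hrε
    rw [zero_add, h.map_zero, zero_add] at h3
    have h4 : lam * m ≤ 1 := by nlinarith [le_abs_self m]
    calc lam * π r = lam * m * r := by rw [h3]; ring
      _ ≤ 1 * r := mul_le_mul_of_nonneg_right h4 hr
      _ = r := one_mul r
  · calc lam * π r ≤ lam * 1 := mul_le_mul_of_nonneg_left (h.le_one r) hl.le
      _ ≤ r := by linarith

/-- A continuous minimal function with two slopes has one positive and one negative slope, and the
negative one is attained to the left of `0`. -/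
theorem exists_neg_slope {b : ℝ} {π : ℝ → ℝ} (h : IsMinimalGJ b π) (hc : Continuous π)
    (hπ : HasSlopeCount Set.univ π 2) {s : ℝ} (hs : s ∈ slopeSet Set.univ π) (hs0 : 0 < s) :
    ∃ q < 0, (∀ m ∈ slopeSet Set.univ π, m = s ∨ m = q) ∧
      ∃ ε > 0, ∀ η, 0 ≤ η → η < ε → π (-η) = -(q * η) := by
  obtain ⟨hpl, hcard⟩ := hπ
  obtain ⟨q, hq⟩ : ∃ q, ∀ m ∈ slopeSet Set.univ π, m = s ∨ m = q := by
    obtain ⟨x, y, -, hxy⟩ := Set.encard_eq_two.1 hcard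
    rw [hxy] at hs ⊢
    rcases hs with rfl | hs
    · exact ⟨y, fun m hm => hm⟩
    · rw [Set.mem_singleton_iff] at hs
      subst hs
      exact ⟨x, fun m hm => hm.symm⟩
  -- Otherwise `π` would be nondecreasing, although it falls from 1 at `b` to 0 at `⌈b⌉`.
  have hq0 : q < 0 := by
    by_contra! hq0
    have := hpl.le_sub_of_le_slope hc (M := 0) (x := b) (y := ⌈b⌉)
      (fun m hm => by rcases hq m hm with rfl | rfl <;> linarith) (Int.le_ceil b)
    have h2 := h.map_add_int 0 ⌈b⌉
    rw [zero_add, h.map_zero] at h2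
    linarith [h.map_rhs]
  refine ⟨q, hq0, hq, ?_⟩
  obtain ⟨m, hm, ε, hε, hlin⟩ := hpl.exists_slope_left (x := 0) hc.continuousWithinAt
  have hlin' : ∀ η, 0 ≤ η → η < ε → π (-η) = -(m * η) := fun η h0 hη => by
    have := hlin η h0 hη
    rwa [zero_sub, h.map_zero, zero_sub] at this
  have hmq : m = q := by
    refine (hq m hm).resolve_left ?_
    rintro rfl
    have h1 := hlin' (ε / 2) (by linarith) (by linarith)
    have h2 := h.nonneg (-(ε / 2))
    have h3 : 0 < m * (ε / 2) := by positivity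
    linarith
  exact ⟨ε, hε, hmq ▸ hlin'⟩

open Filter Topology in
/-- If a function is additive near `(r, v)` in each of the two variables, then its derivative at `v`
is also its derivative at `r`. -/
theorem HasDerivAt.of_eventually_add_eq {ψ : ℝ → ℝ} {m r v : ℝ} (hv : HasDerivAt ψ m v)
    (h₁ : ∀ᶠ h in 𝓝 (0 : ℝ), ψ r + ψ (v + h) = ψ (r + v + h))
    (h₂ : ∀ᶠ h in 𝓝 (0 : ℝ), ψ (r + h) + ψ v = ψ (r + v + h)) : HasDerivAt ψ m r := by
  have hshift : HasDerivAt (fun y => ψ (y + (v - r)) + (ψ r - ψ v)) m r := by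
    refine HasDerivAt.add_const _ (HasDerivAt.comp_add_const r (v - r) ?_)
    rwa [add_sub_cancel]
  refine hshift.congr_of_eventuallyEq ?_
  have ht : Tendsto (fun y : ℝ => y - r) (𝓝 r) (𝓝 0) := by
    have : Continuous fun y : ℝ => y - r := by fun_prop
    simpa using this.tendsto r
  filter_upwards [ht.eventually h₁, ht.eventually h₂] with y hy₁ hy₂
  rw [add_sub_cancel] at hy₂
  have e : v + (y - r) = y + (v - r) := by ring
  rw [e] at hy₁
  linarith

/-! Functions with sums of at most one over pairs and triples -/

/-- Sums of `f` over pairs and triples in `S` with sum at most one are at most one. -/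
def PairTripleSumLeOneOn (S : Set ℝ) (f : ℝ → ℝ) : Prop :=
  (∀ x ∈ S, ∀ y ∈ S, x + y ≤ 1 → f x + f y ≤ 1) ∧
    ∀ x ∈ S, ∀ y ∈ S, ∀ z ∈ S, x + y + z ≤ 1 → f x + f y + f z ≤ 1

namespace PairTripleSumLeOneOn

variable {S : Set ℝ} {f g φ : ℝ → ℝ} {t : ℝ}

/-- Both summands are at most 1 on the pair and their average with positive weights equals 1, so
each is 1. -/
theorem add_one_sub (hf : PairTripleSumLeOneOn S f) (hg : PairTripleSumLeOneOn S g)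
    (hS : ∀ x ∈ S, 1 - x ∈ S) (ht0 : 0 < t) (ht1 : t < 1)
    (hφ : ∀ x ∈ S, φ x = t * f x + (1 - t) * g x) (hsym : ∀ x, φ x + φ (1 - x) = 1)
    {x : ℝ} (hx : x ∈ S) : f x + f (1 - x) = 1 := by
  have h1 := hf.1 x hx _ (hS x hx) (by linarith)
  have h2 := hg.1 x hx _ (hS x hx) (by linarith)
  have h3 := hsym x
  rw [hφ x hx, hφ _ (hS x hx)] at h3
  have h4 : (1 - t) * (g x + g (1 - x)) ≤ (1 - t) * 1 :=
    mul_le_mul_of_nonneg_left h2 (by linarith)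
  refine le_antisymm h1 (le_of_mul_le_mul_left ?_ ht0)
  linarith

theorem mono (hf : PairTripleSumLeOneOn S f) (hS : ∀ x ∈ S, 1 - x ∈ S)
    (hsym : ∀ x ∈ S, f x + f (1 - x) = 1) : MonotoneOn f S := by
  intro x hx y hy hxy
  linarith [hf.1 x hx _ (hS y hy) (by linarith), hsym y hy]

/-- The triple `x`, `y`, `1 - (x + y)` has sum 1; symmetry rewrites its third value. -/
theorem superadditive (hf : PairTripleSumLeOneOn S f) (hS : ∀ x ∈ S, 1 - x ∈ S)
    (hsym : ∀ x ∈ S, f x + f (1 - x) = 1) {x y : ℝ} (hx : x ∈ S) (hy : y ∈ S)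
    (hxy : x + y ∈ S) : f x + f y ≤ f (x + y) := by
  linarith [hf.2 x hx y hy _ (hS _ hxy) (by linarith), hsym _ hxy]

end PairTripleSumLeOneOn

/-! Local slopes and the derivative of summands -/

/-- `π` is affine with slope `q` near `r`. -/
def HasLocalSlope (π : ℝ → ℝ) (q r : ℝ) : Prop :=
  ∃ ε > 0, ∀ h, |h| < ε → π (r + h) = π r + q * h

section TwoSlope

variable {b q ε : ℝ} {π ψ : ℝ → ℝ} {D : Set ℝ} {k : ℤ}

open Filter Topology in
-- For `v` just left of `k`, both `r` and `r + v - k` lie on the same piece of slope `q`. Thus `π r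
-- + π v = π (r + v)`, also after a small perturbation of either variable, and `ψ` inherits these
-- equalities.
theorem exists_hasDerivAt_transfer (hper : ∀ (r : ℝ) (n : ℤ), π (r + n) = π r)
    (hleft : ∀ η, 0 ≤ η → η < ε → π (-η) = -(q * η)) (hε : 0 < ε) (hD : IsOpen D)
    (hadd : ∀ x ∈ D, ∀ y ∈ D, x + y ∈ D → π x + π y = π (x + y) → ψ x + ψ y = ψ (x + y))
    (hU : Set.Ioo (k - ε) k ⊆ D) {r : ℝ} (hr : r ∈ D) (hslope : HasLocalSlope π q r)
    (hrU : ∀ v ∈ Set.Ioo (k - ε) (k : ℝ), r + v ∈ D) :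
    ∃ η₁ > 0, η₁ ≤ ε ∧ ∀ v ∈ Set.Ioo (k - η₁) (k : ℝ), ∀ m, HasDerivAt ψ m v →
      HasDerivAt ψ m r := by
  obtain ⟨ρ, hρ, hlin⟩ := hslope
  refine ⟨min ε ρ, lt_min hε hρ, min_le_left _ _, fun v hv m hm => ?_⟩
  have hv1 : k - v < ε := lt_of_lt_of_le (by linarith [hv.1]) (min_le_left ε ρ)
  have hv2 : k - v < ρ := lt_of_lt_of_le (by linarith [hv.1]) (min_le_right ε ρ)
  have hv0 := hv.2
  have hvU : v ∈ Set.Ioo (k - ε) (k : ℝ) := ⟨by linarith, hv0⟩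
  have hnear : ∀ {x : ℝ}, x ∈ D → ∀ᶠ h in 𝓝 (0 : ℝ), x + h ∈ D := by
    intro x hx
    have : Continuous fun h : ℝ => x + h := by fun_prop
    exact this.continuousAt.eventually_mem (hD.mem_nhds (by simpa using hx))
  have hsmall : ∀ᶠ h in 𝓝 (0 : ℝ), |h| < min ρ (min (k - v) (min (ε - (k - v)) (ρ - (k - v)))) := by
    have : Continuous fun h : ℝ => |h| := by fun_prop
    refine this.continuousAt.eventually_lt continuousAt_const ?_
    rw [abs_zero]
    refine lt_min hρ (lt_min ?_ (lt_min ?_ ?_)) <;> linarith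
  have hπv : ∀ h, |h| < k - v → |h| < ε - (k - v) → π (v + h) = -(q * (k - (v + h))) := by
    intro h h1 h2
    rw [abs_lt] at h1 h2
    rw [← hleft (k - (v + h)) (by linarith) (by linarith), ← hper (-(k - (v + h))) k]
    congr 1
    ring
  have hπr : ∀ h, |h| < ρ - (k - v) → π (r + v + h) = π r + q * (v + h - k) := by
    intro h h1
    rw [abs_lt] at h1
    rw [← hlin (v + h - k) (abs_lt.2 ⟨by linarith, by linarith⟩), ← hper (r + (v + h - k)) k]
    congr 1
    ring
  refine hm.of_eventually_add_eq ?_ ?_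
  · filter_upwards [hsmall, hnear (hU hvU), hnear (hrU v hvU)] with h hh hD1 hD2
    simp only [lt_min_iff] at hh
    rw [add_assoc] at hD2 ⊢
    refine hadd _ hr _ hD1 hD2 ?_
    rw [hπv h hh.2.1 hh.2.2.1, ← add_assoc, hπr h hh.2.2.2]
    ring
  · filter_upwards [hsmall, hnear hr, hnear (hrU v hvU)] with h hh hD1 hD2
    simp only [lt_min_iff] at hh
    have e : r + v + h = r + h + v := by ring
    have h1 := hπv 0 (by rw [abs_zero]; linarith) (by rw [abs_zero]; linarith)
    have h2 := hπr h hh.2.2.2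
    rw [add_zero] at h1
    rw [e] at hD2 h2 ⊢
    refine hadd _ hD1 _ (hU hvU) hD2 ?_
    rw [h1, h2, hlin h hh.1]
    ring

/-- Monotonicity supplies points of differentiability arbitrarily close to `k`. One of them, `v₀`,
is fixed as reference; a point close enough to `k` then transfers its derivative both to `v₀` and to
`r`, so the two agree. -/
theorem exists_hasDerivAt_of_hasLocalSlope (hper : ∀ (r : ℝ) (n : ℤ), π (r + n) = π r)
    (hleft : ∀ η, 0 ≤ η → η < ε → π (-η) = -(q * η)) (hε : 0 < ε) (hD : IsOpen D)
    (hadd : ∀ x ∈ D, ∀ y ∈ D, x + y ∈ D → π x + π y = π (x + y) → ψ x + ψ y = ψ (x + y))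
    (hmono : MonotoneOn ψ D) (hU : Set.Ioo (k - ε) k ⊆ D)
    (hUU : ∀ v ∈ Set.Ioo (k - ε) (k : ℝ), ∀ w ∈ Set.Ioo (k - ε) (k : ℝ), v + w ∈ D) :
    ∃ m, ∀ r ∈ D, HasLocalSlope π q r → (∀ v ∈ Set.Ioo (k - ε) (k : ℝ), r + v ∈ D) →
      HasDerivAt ψ m r := by
  have hdiff : ∀ η > 0, η ≤ ε → ∃ v ∈ Set.Ioo (k - η) (k : ℝ), DifferentiableAt ℝ ψ v := by
    intro η hη hηε
    have hae := (hmono.mono hU).ae_differentiableWithinAt_of_mem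
    obtain ⟨v, hv, hvd⟩ := (MeasureTheory.Measure.dense_of_ae hae).exists_mem_open
      (isOpen_Ioo (a := (k : ℝ) - η) (b := k)) ⟨k - η / 2, by linarith, by linarith⟩
    have hvU : v ∈ Set.Ioo (k - ε) (k : ℝ) := ⟨by linarith [hvd.1], hvd.2⟩
    exact ⟨v, hvd, (hv hvU).differentiableAt (isOpen_Ioo.mem_nhds hvU)⟩
  obtain ⟨v₀, hv₀, hd₀⟩ := hdiff ε hε le_rfl
  have hslope₀ : HasLocalSlope π q v₀ := by
    have hπv : ∀ v ∈ Set.Ioo (k - ε) (k : ℝ), π v = -(q * (k - v)) := by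
      intro v hv
      rw [← hleft (k - v) (by linarith [hv.2]) (by linarith [hv.1]), ← hper (-(k - v)) k]
      congr 1
      ring
    refine ⟨min (k - v₀) (v₀ - (k - ε)), lt_min (by linarith [hv₀.2]) (by linarith [hv₀.1]),
      fun h hh => ?_⟩
    rw [lt_min_iff, abs_lt, abs_lt] at hh
    rw [hπv v₀ hv₀, hπv (v₀ + h) ⟨by linarith, by linarith⟩]
    ring
  obtain ⟨η₀, hη₀, -, htrans₀⟩ := exists_hasDerivAt_transfer hper hleft hε hD hadd hU (hU hv₀)
    hslope₀ (hUU v₀ hv₀)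
  refine ⟨deriv ψ v₀, fun r hr hslope hrU => ?_⟩
  obtain ⟨η₁, hη₁, hη₁ε, htrans⟩ := exists_hasDerivAt_transfer hper hleft hε hD hadd hU hr
    hslope hrU
  obtain ⟨v, hv, hd⟩ := hdiff (min η₀ η₁) (lt_min hη₀ hη₁) ((min_le_right _ _).trans hη₁ε)
  have hm₀ := htrans₀ v ⟨by linarith [hv.1, min_le_left η₀ η₁], hv.2⟩ _ hd.hasDerivAt
  have hm := htrans v ⟨by linarith [hv.1, min_le_right η₀ η₁], hv.2⟩ _ hd.hasDerivAt
  rwa [← hm₀.deriv] at hm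

open Filter Topology in
/-- A function dominated by `r ↦ s * r - π r` whose derivative is constant where `π` has slope `q`
is proportional to it. -/
theorem sub_eq_mul_sub_of_hasDerivAt {s C m p p' : ℝ} (hpl : IsPiecewiseLinearOn Set.univ π)
    (hc : Continuous π) (hslopes : ∀ a ∈ slopeSet Set.univ π, a = s ∨ a = q) (hqs : q < s)
    (hpp : p ≤ p')
    (hmono : MonotoneOn ψ (Set.Icc p p'))
    (hdom : ∀ x ∈ Set.Icc p p', ∀ y ∈ Set.Icc p p', x ≤ y →
      ψ y - ψ x ≤ C * ((s * y - π y) - (s * x - π x)))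
    (hderiv : ∀ r ∈ Set.Ioo p p', HasLocalSlope π q r → HasDerivAt ψ m r) :
    ψ p' - ψ p = m / (s - q) * ((s * p' - π p') - (s * p - π p)) := by
  have hsq : s - q ≠ 0 := by linarith
  have habs : ∀ x ∈ Set.Icc p p', ∀ y ∈ Set.Icc p p',
      |ψ y - ψ x| ≤ |C * ((s * y - π y) - (s * x - π x))| := by
    intro x hx y hy
    rcases le_total x y with hxy | hxy
    · rw [abs_of_nonneg (sub_nonneg.2 (hmono hx hy hxy))]
      exact (hdom x hx y hy hxy).trans (le_abs_self _)
    · rw [abs_sub_comm, abs_of_nonneg (sub_nonneg.2 (hmono hy hx hxy))]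
      refine (hdom y hy x hx hxy).trans ((le_abs_self _).trans_eq ?_)
      rw [← abs_neg]
      congr 1
      ring
  have hcont : ContinuousOn ψ (Set.Icc p p') := by
    intro x hx
    rw [ContinuousWithinAt, tendsto_iff_norm_sub_tendsto_zero]
    have hlim : Tendsto (fun y => |C * ((s * y - π y) - (s * x - π x))|)
        (𝓝[Set.Icc p p'] x) (𝓝 0) := by
      have : Continuous fun y => |C * ((s * y - π y) - (s * x - π x))| := by fun_prop
      simpa using (this.tendsto x).mono_left nhdsWithin_le_nhds
    refine squeeze_zero' (Eventually.of_forall fun _ => norm_nonneg _) ?_ hlim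
    filter_upwards [self_mem_nhdsWithin] with y hy
    exact habs x hx y hy
  obtain ⟨B, hB, hoff⟩ := hpl.exists_countable_affine
  -- On pieces of slope `s` the dominating function is constant, hence so is `ψ`; on pieces of slope
  -- `q` the derivative `m` cancels.
  have hF : ∀ x ∈ Set.Ioo p p' \ B,
      HasDerivAt (fun r => ψ r - m / (s - q) * (s * r - π r)) 0 x := by
    rintro x ⟨hx, hxB⟩
    obtain ⟨a, ha, ρ, hρ, hlin⟩ := hoff x hxB
    have hπ : HasDerivAt π a x := by
      have h1 : HasDerivAt (fun y => π x + a * (y - x)) a x := by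
        simpa using (((hasDerivAt_id x).sub_const x).const_mul a).const_add (π x)
      refine h1.congr_of_eventuallyEq ?_
      filter_upwards [Metric.ball_mem_nhds x hρ] with y hy
      rw [← hlin (y - x) (by simpa [Real.dist_eq] using hy), add_sub_cancel]
    have hG : HasDerivAt (fun r => s * r - π r) (s - a) x := by
      simpa using ((hasDerivAt_id x).const_mul s).fun_sub hπ
    rcases hslopes a ha with rfl | rfl
    · have hψ : HasDerivAt ψ 0 x := by
        refine (hasDerivAt_const x (ψ x)).congr_of_eventuallyEq ?_
        filter_upwards [Metric.ball_mem_nhds x hρ, Ioo_mem_nhds hx.1 hx.2] with y hy hy'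
        have h1 := hlin (y - x) (by simpa [Real.dist_eq] using hy)
        rw [add_sub_cancel] at h1
        have h2 := habs x (Set.Ioo_subset_Icc_self hx) y (Set.Ioo_subset_Icc_self hy')
        have h3 : C * ((a * y - π y) - (a * x - π x)) = 0 := by rw [h1]; ring
        rw [h3, abs_zero] at h2
        linarith [abs_nonpos_iff.1 h2]
      simpa using hψ.fun_sub (hG.const_mul (m / (a - q)))
    · have := (hderiv x hx ⟨ρ, hρ, hlin⟩).fun_sub (hG.const_mul (m / (s - a)))
      rwa [div_mul_cancel₀ _ hsq, sub_self] at this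
  have := MeasureTheory.integral_eq_of_hasDerivAt_off_countable_of_le
    (fun r => ψ r - m / (s - q) * (s * r - π r)) (fun _ => 0) hpp hB
    (hcont.sub (by fun_prop)) hF (by simp)
  simp only [intervalIntegral.integral_zero] at this
  linarith

end TwoSlope

/-! ### Extremality for two slopes -/

section Extreme

variable {b s q ε t : ℝ} {π f g : ℝ → ℝ} {S D : Set ℝ} {k : ℤ}

theorem gjToDFF_one_div (hs : 0 < s) (hsb : 1 < s * b) (x : ℝ) :
    gjToDFF b π (1 / s) x = (s * (b * x) - π (b * x)) / (s * b - 1) := by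
  have h1 : s * b - 1 ≠ 0 := by linarith
  have h2 : b - 1 / s ≠ 0 := by
    rw [ne_eq, sub_eq_zero, eq_div_iff hs.ne']
    linarith
  rw [gjToDFF, div_eq_div_iff h2 h1]
  field_simp

/-- A summand of a converted two-slope function is that function itself. The set `D` is the interior
of the domain after rescaling by `b`. -/
theorem eqOn_gjToDFF_of_convexCombination (hb : 0 < b) (h : IsMinimalGJ b π) (hc : Continuous π)
    (hpl : IsPiecewiseLinearOn Set.univ π) (hs : 0 < s) (hsb : 1 < s * b) (hq : q < 0)
    (hslopes : ∀ a ∈ slopeSet Set.univ π, a = s ∨ a = q) (hε : 0 < ε)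
    (hleft : ∀ η, 0 ≤ η → η < ε → π (-η) = -(q * η))
    (ht0 : 0 < t) (ht1 : t < 1) (hf : PairTripleSumLeOneOn S f) (hg : PairTripleSumLeOneOn S g)
    (hφ : ∀ x ∈ S, gjToDFF b π (1 / s) x = t * f x + (1 - t) * g x)
    (hS : ∀ x ∈ S, 1 - x ∈ S) (h0S : (0 : ℝ) ∈ S) (hSord : S.OrdConnected)
    (hD : IsOpen D) (hDS : ∀ r ∈ D, r / b ∈ S)
    (hSD : ∀ x ∈ S, ∀ y ∈ S, Set.Ioo (b * x) (b * y) ⊆ D)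
    (hU : Set.Ioo (k - ε) k ⊆ D)
    (hUU : ∀ v ∈ Set.Ioo (k - ε) (k : ℝ), ∀ w ∈ Set.Ioo (k - ε) (k : ℝ), v + w ∈ D)
    (hcover : ∀ r ∈ D, (∀ v ∈ Set.Ioo (k - ε) (k : ℝ), r + v ∈ D) ∨
      (b - r ∈ D ∧ ∀ v ∈ Set.Ioo (k - ε) (k : ℝ), b - r + v ∈ D)) :
    Set.EqOn f (gjToDFF b π (1 / s)) S := by
  have hlb : 1 / s < b := by
    rw [div_lt_iff₀ hs]
    linarith
  have hd : 0 < s * b - 1 := by linarith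
  have hval : ∀ r, gjToDFF b π (1 / s) (r / b) = (s * r - π r) / (s * b - 1) := by
    intro r
    rw [gjToDFF_one_div hs hsb, mul_div_cancel₀ _ hb.ne']
  set φ := gjToDFF b π (1 / s) with hφdef
  have hφsym : ∀ x, φ x + φ (1 - x) = 1 := gjToDFF_add_one_sub h hlb
  have hfsym : ∀ x ∈ S, f x + f (1 - x) = 1 := fun x hx =>
    hf.add_one_sub hg hS ht0 ht1 hφ hφsym hx
  have hgsym : ∀ x ∈ S, g x + g (1 - x) = 1 := fun x hx =>
    hg.add_one_sub hf hS (t := 1 - t) (by linarith) (by linarith)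
      (fun x hx => by rw [hφ x hx]; ring) hφsym hx
  have hfmono := hf.mono hS hfsym
  have hgmono := hg.mono hS hgsym
  have hf0 : f 0 = 0 := by
    have h1 := hf.superadditive hS hfsym h0S h0S (by simpa using h0S)
    have h2 := hg.superadditive hS hgsym h0S h0S (by simpa using h0S)
    rw [add_zero] at h1 h2
    have h3 := hφ 0 h0S
    rw [hφdef, gjToDFF_zero h] at h3
    nlinarith
  have h1S : (1 : ℝ) ∈ S := by simpa using hS 0 h0S
  have hf1 : f 1 = 1 := by
    have := hfsym 0 h0S
    rwa [hf0, zero_add, sub_zero] at this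
  -- Both summands are superadditive, so equality in their weighted sum forces equality in each.
  have hftight : ∀ x ∈ S, ∀ y ∈ S, x + y ∈ S → φ x + φ y = φ (x + y) →
      f x + f y = f (x + y) := by
    intro x hx y hy hxy he
    have h1 := hf.superadditive hS hfsym hx hy hxy
    have h2 := hg.superadditive hS hgsym hx hy hxy
    rw [hφ x hx, hφ y hy, hφ _ hxy] at he
    have h3 : (1 - t) * (g x + g y) ≤ (1 - t) * g (x + y) :=
      mul_le_mul_of_nonneg_left h2 (by linarith)
    refine le_antisymm h1 (le_of_mul_le_mul_left ?_ ht0)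
    linarith
  have hfdom : ∀ x ∈ S, ∀ y ∈ S, x ≤ y → f y - f x ≤ 1 / t * (φ y - φ x) := by
    intro x hx y hy hxy
    have h1 := mul_le_mul_of_nonneg_left (hgmono hx hy hxy) (show 0 ≤ 1 - t by linarith)
    rw [hφ x hx, hφ y hy, one_div, ← div_eq_inv_mul, le_div_iff₀ ht0]
    linarith
  set ψ : ℝ → ℝ := fun r => f (r / b) with hψ
  have hψadd : ∀ x ∈ D, ∀ y ∈ D, x + y ∈ D → π x + π y = π (x + y) →
      ψ x + ψ y = ψ (x + y) := by
    intro x hx y hy hxy he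
    have hxy' := hDS _ hxy
    simp only [hψ]
    rw [add_div] at hxy' ⊢
    refine hftight _ (hDS x hx) _ (hDS y hy) hxy' ?_
    rw [← add_div, hval, hval, hval, ← he]
    ring
  have hψmono : MonotoneOn ψ D := fun x hx y hy hxy =>
    hfmono (hDS x hx) (hDS y hy) (div_le_div_of_nonneg_right hxy hb.le)
  obtain ⟨m, hm⟩ := exists_hasDerivAt_of_hasLocalSlope h.map_add_int hleft hε hD hψadd hψmono
    hU hUU
  have hderiv : ∀ r ∈ D, HasLocalSlope π q r → HasDerivAt ψ m r := by
    intro r hr hslope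
    -- If `r + v` leaves the domain, the derivative is found at `b - r` instead and reflected back
    -- by the symmetry of `f`; reflection preserves the local slope of `π`.
    rcases hcover r hr with hrU | ⟨hbr, hbrU⟩
    · exact hm r hr hslope hrU
    · have hslope' : HasLocalSlope π q (b - r) := by
        obtain ⟨ρ, hρ, hlin⟩ := hslope
        refine ⟨ρ, hρ, fun u hu => ?_⟩
        have h1 := hlin (-u) (by rwa [abs_neg])
        have h2 := h.add_sub_eq_one r
        have h3 := h.add_sub_eq_one (r + -u)
        have e : b - (r + -u) = b - r + u := by ring
        rw [e] at h3
        linarith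
      have h1 := (hm _ hbr hslope' hbrU).comp_const_sub b r
      have h2 := h1.const_sub 1
      rw [neg_neg] at h2
      refine h2.congr_of_eventuallyEq ?_
      filter_upwards [hD.mem_nhds hr] with y hy
      have h3 := hfsym _ (hDS y hy)
      have e : 1 - y / b = (b - y) / b := by field_simp
      rw [e] at h3
      simp only [hψ]
      linarith
  have hinterval : ∀ x ∈ S, ∀ y ∈ S, x ≤ y →
      f y - f x = m / (s - q) * ((s * (b * y) - π (b * y)) - (s * (b * x) - π (b * x))) := by
    intro x hx y hy hxy
    have hIcc : ∀ z ∈ Set.Icc (b * x) (b * y), z / b ∈ S := fun z hz =>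
      hSord.out hx hy ⟨by rw [le_div_iff₀ hb]; linarith [hz.1],
        by rw [div_le_iff₀ hb]; linarith [hz.2]⟩
    have := sub_eq_mul_sub_of_hasDerivAt (ψ := ψ) (C := 1 / t * (1 / (s * b - 1))) (m := m)
      hpl hc hslopes (by linarith) (mul_le_mul_of_nonneg_left hxy hb.le)
      (fun z hz w hw hzw => hfmono (hIcc z hz) (hIcc w hw) (div_le_div_of_nonneg_right hzw hb.le))
      (fun z hz w hw hzw => by
        refine (hfdom _ (hIcc z hz) _ (hIcc w hw)
          (div_le_div_of_nonneg_right hzw hb.le)).trans_eq ?_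
        rw [hval, hval]
        ring)
      (fun r hr => hderiv r (hSD x hx y hy hr))
    simpa only [hψ, mul_div_cancel_left₀ _ hb.ne'] using this
  -- The increment of `f` from 0 to 1 fixes the constant of proportionality.
  have hκ : m / (s - q) * (s * b - 1) = 1 := by
    have := hinterval 0 h0S 1 h1S zero_le_one
    simp only [mul_one, mul_zero, h.map_zero, h.map_rhs, hf0, hf1] at this
    linarith
  intro x hx
  have hx' : f x = m / (s - q) * (s * (b * x) - π (b * x)) := by
    rcases le_total 0 x with hx0 | hx0
    · have := hinterval 0 h0S x hx hx0
      simp only [mul_zero, h.map_zero, hf0] at this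
      linarith
    · have := hinterval x hx 0 h0S hx0
      simp only [mul_zero, h.map_zero, hf0] at this
      linarith
  rw [hx', hφdef, gjToDFF_one_div hs hsb, eq_div_iff hd.ne']
  linear_combination (s * (b * x) - π (b * x)) * hκ

theorem IsGeneralDFF.pairTripleSumLeOneOn {φ : ℝ → ℝ} (hφ : IsGeneralDFF φ) :
    PairTripleSumLeOneOn Set.univ φ := by
  refine ⟨fun x _ y _ hxy => ?_, fun x _ y _ z _ hxyz => ?_⟩
  · simpa using hφ 2 ![x, y] (by simpa using hxy)
  · simpa [Fin.sum_univ_three] using hφ 3 ![x, y, z] (by simpa [Fin.sum_univ_three] using hxyz)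

theorem IsClassicalDFF.pairTripleSumLeOneOn {φ : Set.Icc (0 : ℝ) 1 → ℝ} (hφ : IsClassicalDFF φ) :
    PairTripleSumLeOneOn (Set.Icc 0 1) (Set.IccExtend zero_le_one φ) := by
  refine ⟨fun x hx y hy hxy => ?_, fun x hx y hy z hz hxyz => ?_⟩
  · rw [Set.IccExtend_of_mem _ _ hx, Set.IccExtend_of_mem _ _ hy]
    simpa using hφ.2 2 ![⟨x, hx⟩, ⟨y, hy⟩] (by simpa using hxy)
  · rw [Set.IccExtend_of_mem _ _ hx, Set.IccExtend_of_mem _ _ hy, Set.IccExtend_of_mem _ _ hz]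
    simpa [Fin.sum_univ_three] using hφ.2 3 ![⟨x, hx⟩, ⟨y, hy⟩, ⟨z, hz⟩]
      (by simpa [Fin.sum_univ_three] using hxyz)

theorem pos_and_lt_one_of_convexCombination {α : Type*} {φ φ₁ φ₂ : α → ℝ} (h₁ : φ₁ ≠ φ)
    (h₂ : φ₂ ≠ φ) (ht0 : 0 ≤ t) (ht1 : t ≤ 1) (h : ∀ x, φ x = t * φ₁ x + (1 - t) * φ₂ x) :
    0 < t ∧ t < 1 := by
  refine ⟨ht0.lt_of_ne ?_, ht1.lt_of_ne ?_⟩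
  · rintro rfl
    exact h₂ (funext fun x => by simp [h x])
  · rintro rfl
    exact h₁ (funext fun x => by simp [h x])

theorem gjToDFF_extreme (hb : 0 < b) (h : IsMinimalGJ b π) (hc : Continuous π)
    (hcount : HasSlopeCount Set.univ π 2) (hsmem : s ∈ slopeSet Set.univ π) (hs : 0 < s)
    (hsb : 1 < s * b) :
    IsExtremeGeneralDFF (gjToDFF b π (1 / s)) ∧
      (3 < b → IsExtremeClassicalDFF
        ((Set.Icc (0 : ℝ) 1).domRestrict (gjToDFF b π (1 / s)))) := by
  obtain ⟨q, hq, hslopes, ε, hε, hleft⟩ := exists_neg_slope h hc hcount hsmem hs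
  have hpl := hcount.1
  have hlb : 1 / s < b := by
    rw [div_lt_iff₀ hs]
    linarith
  -- No slope exceeds `s`, so `π r ≤ s * r`, and `1 / s` is small enough for maximality.
  have hle : ∀ r, 0 ≤ r → 1 / s * π r ≤ r := by
    intro r hr
    have := hpl.sub_le_of_slope_le hc (M := s)
      (fun a ha => by rcases hslopes a ha with rfl | rfl <;> linarith) hr
    rw [h.map_zero, sub_zero, sub_zero] at this
    rw [one_div, ← div_eq_inv_mul, div_le_iff₀ hs]
    linarith
  have hmax := gjToDFF_maximal hb h (one_div_pos.2 hs).le hlb hle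
  refine ⟨⟨hmax.1, ?_⟩, fun hb3 => ⟨hmax.2, ?_⟩⟩
  · rintro ⟨φ₁, φ₂, t, h₁, h₂, hne₁, hne₂, ht0, ht1, hφ⟩
    obtain ⟨ht0, ht1⟩ := pos_and_lt_one_of_convexCombination hne₁ hne₂ ht0 ht1 hφ
    refine hne₁ (funext fun x => ?_)
    exact eqOn_gjToDFF_of_convexCombination (D := Set.univ) (k := 0) hb h hc hpl hs hsb hq hslopes
      hε hleft ht0 ht1 h₁.1.pairTripleSumLeOneOn h₂.1.pairTripleSumLeOneOn (fun x _ => hφ x)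
      (by simp) (by simp) Set.ordConnected_univ isOpen_univ (by simp) (by simp) (by simp) (by simp)
      (by simp) (Set.mem_univ x)
  · rintro ⟨φ₁, φ₂, t, h₁, h₂, hne₁, hne₂, ht0, ht1, hφ⟩
    obtain ⟨ht0, ht1⟩ := pos_and_lt_one_of_convexCombination hne₁ hne₂ ht0 ht1 hφ
    refine hne₁ (funext fun x => ?_)
    have hε1 := min_le_right ε 1
    -- Points left of 0 are outside the domain, so the window is taken left of `k = 1`; capping `ε`
    -- at 1 keeps it in `(0, 1)`. Sums of two window points stay below 2, hence below `b`. Points `r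
    -- ≥ b - 1` are reflected to `b - r ≤ 1`.
    have key := eqOn_gjToDFF_of_convexCombination (D := Set.Ioo 0 b) (k := 1) (ε := min ε 1)
      (S := Set.Icc 0 1) hb h hc hpl hs hsb hq hslopes (lt_min hε one_pos)
      (fun η h0 hη => hleft η h0 (lt_of_lt_of_le hη (min_le_left _ _))) ht0 ht1
      h₁.1.pairTripleSumLeOneOn h₂.1.pairTripleSumLeOneOn
      (fun x hx => by
        rw [Set.IccExtend_of_mem _ _ hx, Set.IccExtend_of_mem _ _ hx, ← hφ ⟨x, hx⟩]
        rfl)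
      (fun x hx => ⟨by linarith [hx.2], by linarith [hx.1]⟩) (by simp) Set.ordConnected_Icc
      isOpen_Ioo
      (fun r hr => ⟨div_nonneg hr.1.le hb.le, (div_le_one hb).2 hr.2.le⟩)
      (fun x hx y hy r hr => ⟨lt_of_le_of_lt (mul_nonneg hb.le hx.1) hr.1,
        lt_of_lt_of_le hr.2 (mul_le_of_le_one_right hb.le hy.2)⟩)
      (by
        rintro v ⟨h1, h2⟩
        push_cast at h1 h2
        exact ⟨by linarith, by linarith⟩)
      (by
        rintro v ⟨h1, h2⟩ w ⟨h3, h4⟩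
        push_cast at h1 h2 h3 h4
        exact ⟨by linarith, by linarith⟩)
      (by
        rintro r ⟨hr0, hrb⟩
        rcases lt_or_ge r (b - 1) with hr | hr
        · left
          rintro v ⟨h1, h2⟩
          push_cast at h1 h2
          exact ⟨by linarith, by linarith⟩
        · right
          refine ⟨⟨by linarith, by linarith⟩, ?_⟩
          rintro v ⟨h1, h2⟩
          push_cast at h1 h2
          exact ⟨by linarith, by linarith⟩)
      x.2
    rwa [Set.IccExtend_val] at key

end Extreme

theorem theorem1 (b : ℝ) (hb : 0 < b) (hbZ : ∀ n : ℤ, b ≠ (n : ℝ)) (π : ℝ → ℝ)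
    (hmin : IsMinimalGJ b π) (hpl : IsPiecewiseLinearOn Set.univ π)
    (hcont : ContinuousWithinAt π (Set.Ici 0) 0) :
    (∃ δ : ℝ, 0 < δ ∧ ∀ lam : ℝ, 0 < lam → lam < δ →
      IsMaximalGeneralDFF (gjToDFF b π lam) ∧
      IsMaximalClassicalDFF ((Set.Icc (0 : ℝ) 1).domRestrict (gjToDFF b π lam)) ∧
      (∀ k : ℕ, HasSlopeCount Set.univ π k ↔ HasSlopeCount Set.univ (gjToDFF b π lam) k) ∧
      (1 < b → ∀ k : ℕ,
        HasSlopeCount Set.univ π k ↔ HasSlopeCount (Set.Icc 0 1) (gjToDFF b π lam) k)) ∧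
    (Continuous π → HasSlopeCount Set.univ π 2 →
      ∀ s : ℝ, s ∈ slopeSet Set.univ π → 0 < s → 1 < s * b →
        IsExtremeGeneralDFF (gjToDFF b π (1 / s)) ∧
        (3 < b →
          IsExtremeClassicalDFF ((Set.Icc (0 : ℝ) 1).domRestrict (gjToDFF b π (1 / s))))) := by
  refine ⟨?_, fun hc hcount s hsmem hs hsb => gjToDFF_extreme hb hmin hc hcount hsmem hs hsb⟩
  obtain ⟨δ, hδ, hle⟩ := exists_forall_mul_le_self hmin hpl hcont
  -- The bound by `b` keeps the denominator `b - lam` positive.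
  refine ⟨min δ b, lt_min hδ hb, fun lam hl hlt => ?_⟩
  have hlb : lam < b := lt_of_lt_of_le hlt (min_le_right _ _)
  obtain ⟨hgen, hcls⟩ := gjToDFF_maximal hb hmin hl.le hlb
    (hle lam hl (lt_of_lt_of_le hlt (min_le_left _ _)))
  refine ⟨hgen, hcls, hasSlopeCount_gjToDFF_iff hb hl hlb hpl rfl, fun hb1 =>
    hasSlopeCount_gjToDFF_iff hb hl hlb hpl ?_⟩
  have e : (fun x => x / b) ⁻¹' Set.Icc 0 1 = Set.Icc 0 b := by
    ext x
    simp [div_le_one hb, le_div_iff₀ hb]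
  rw [e]
  exact slopeSet_Icc_of_periodic hmin.map_add_int hb1.le
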